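/- Let $E=(E^0,E^1,r,s)$ be an arbitrary directed graph and $K$ a field. The Leavitt path algebra $L_K(E)$ is the (not necessarily unital) associative $K$-algebra generated by the vertices $v\in E^0$, the edges $e\in E^1$ and the ghost edges $e^*$ ($e\in E^1$), subject to the relations $vw=\delta_{v,w}v$ for $v,w\in E^0$; $s(e)e=e\,r(e)=e$ and $r(e)e^*=e^*s(e)=e^*$ for $e\in E^1$; $e^*f=\delta_{e,f}\,r(e)$ for $e,f\in E^1$; and $v=\sum_{s(e)=v}ee^*$ for every $v\in E^0$ with $s^{-1}(v)$ finite and non-empty. Say that a vertex $v$ connects to a vertex $w$ if there is a path in $E$ (possibly of length $0$) from $v$ to $w$; a set $H\subseteq E^0$ is hereditary if $v\in H$ and $v$ connects to $w$ imply $w\in H$. For $X \subseteq E^0$ let $I(X)$ be the two-sided ideal of $L_K(E)$ generated by $X$. A left (respectively, right) ideal $J$ of a ring $R$ is dense if for all $x,y\in R$ with $x\neq 0$ there is $r\in R$ with $rx\neq 0$ and $ry\in J$ (respectively, $xr\neq 0$ and $yr\in J$). **Proposition 1.10.** Let $H$ be a hereditary subset of $E^0$. Then: 1. $I(H)$ is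 dense as a left ideal of $L_K(E)$ if and only if every vertex of $E$ connects to a vertex in $H$; 2. $I(H)$ is dense as a right ideal of $L_K(E)$ if and only if every vertex of $E$ connects to a vertex in $H$. -/

import Mathlib

/-!
Directed graphs are Mathlib quivers: the vertices form the type `V`, the edges form the type
`Quiver.Total V`, and an edge `e` has source `e.left` and range `e.right`.  Paths are
`Quiver.Path`; they include the paths of length zero.
-/

namespace LPA

section Graph

variable {V : Type*} [Quiver V]

/-- `v ≥ w`, or "`v` connects to `w`": there is a path (possibly of length `0`) from `v` to `w`. -/
def Connects (v w : V) : Prop := Nonempty (Quiver.Path v w)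

/-- A set of vertices is hereditary if it is closed under going along paths. -/
def IsHereditary (H : Set V) : Prop := ∀ v w : V, v ∈ H → Connects v w → w ∈ H

/-- The set `s⁻¹(v)` of the edges emitted by `v`. -/
def outEdges (v : V) : Set (Quiver.Total V) := {e | e.left = v}

/-- A vertex is regular if it is neither a sink nor an infinite emitter. -/
def IsRegular (v : V) : Prop := (outEdges v).Nonempty ∧ (outEdges v).Finite

end Graph

/-- Generators of the Leavitt path algebra: vertices, (real) edges and ghost edges. -/
inductive Gen (V : Type*) [Quiver V]
  | vertex (v : V)
  | edge (e : Quiver.Total V)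
  | ghost (e : Quiver.Total V)

/-- The free associative non-unital `K`-algebra on the vertices, edges and ghost edges. -/
abbrev FreeAlg (K : Type*) [Field K] (V : Type*) [Quiver V] : Type _ :=
  MonoidAlgebra K (FreeSemigroup (Gen V))

section Relations

variable (K : Type*) [Field K] {V : Type*} [Quiver V]

/-- A vertex as an element of the free algebra. -/
noncomputable def fv (v : V) : FreeAlg K V :=
  MonoidAlgebra.single (FreeSemigroup.of (Gen.vertex v)) 1

/-- An edge as an element of the free algebra. -/
noncomputable def fe (e : Quiver.Total V) : FreeAlg K V :=
  MonoidAlgebra.single (FreeSemigroup.of (Gen.edge e)) 1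

/-- A ghost edge as an element of the free algebra. -/
noncomputable def fg (e : Quiver.Total V) : FreeAlg K V :=
  MonoidAlgebra.single (FreeSemigroup.of (Gen.ghost e)) 1

/-- The defining relations of the Leavitt path algebra: `Rel K a b` stands for `a = b`. -/
inductive Rel : FreeAlg K V → FreeAlg K V → Prop
  /-- (V) `v v = v` -/
  | vertex_self (v : V) : Rel (fv K v * fv K v) (fv K v)
  /-- (V) `v w = 0` for `v ≠ w` -/
  | vertex_ne (v w : V) (h : v ≠ w) : Rel (fv K v * fv K w) 0
  /-- (E1) `s(e) e = e` -/
  | source_edge (e : Quiver.Total V) : Rel (fv K e.left * fe K e) (fe K e)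
  /-- (E1) `e r(e) = e` -/
  | edge_range (e : Quiver.Total V) : Rel (fe K e * fv K e.right) (fe K e)
  /-- (E2) `r(e) e* = e*` -/
  | range_ghost (e : Quiver.Total V) : Rel (fv K e.right * fg K e) (fg K e)
  /-- (E2) `e* s(e) = e*` -/
  | ghost_source (e : Quiver.Total V) : Rel (fg K e * fv K e.left) (fg K e)
  /-- (CK1) `e* e = r(e)` -/
  | ck1_self (e : Quiver.Total V) : Rel (fg K e * fe K e) (fv K e.right)
  /-- (CK1) `e* f = 0` for `e ≠ f` -/
  | ck1_ne (e f : Quiver.Total V) (h : e ≠ f) : Rel (fg K e * fe K f) 0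
  /-- (CK2) `v = ∑ e e*`, the sum over the edges emitted by a regular vertex `v` -/
  | ck2 (v : V) (h : IsRegular v) : Rel (fv K v) (∑ e ∈ h.2.toFinset, fe K e * fg K e)

variable (V) in
/-- The least congruence of `K`-algebras on the free algebra that contains the defining
relations; its zero class is the `K`-algebra ideal generated by the relations. -/
noncomputable def leavittCon : RingCon (FreeAlg K V) :=
  sInf {c | (∀ a b, Rel K a b → c a b) ∧ ∀ (k : K) a b, c a b → c (k • a) (k • b)}

theorem leavittCon_smul (k : K) {a b : FreeAlg K V} (h : leavittCon K V a b) :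
    leavittCon K V (k • a) (k • b) :=
  fun c hc => hc.2 k a b (h c hc)

end Relations

/-- The Leavitt path algebra `L_K(E)` of the graph `E` with vertex type `V`; it is an
associative `K`-algebra, in general without unit. -/
def LeavittPathAlgebra (K : Type*) [Field K] (V : Type*) [Quiver V] : Type _ :=
  (leavittCon K V).Quotient

namespace LeavittPathAlgebra

variable {K : Type*} [Field K] {V : Type*} [Quiver V]

noncomputable instance : NonUnitalRing (LeavittPathAlgebra K V) :=
  inferInstanceAs (NonUnitalRing (leavittCon K V).Quotient)

/-- The quotient map. -/
noncomputable def mk (a : FreeAlg K V) : LeavittPathAlgebra K V :=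
  ((a : (leavittCon K V).Quotient))

theorem mk_surjective : Function.Surjective (mk : FreeAlg K V → LeavittPathAlgebra K V) :=
  Quotient.mk''_surjective

theorem mk_add (a b : FreeAlg K V) : mk (a + b) = mk a + mk b := rfl

theorem mk_mul (a b : FreeAlg K V) : mk (a * b) = mk a * mk b := rfl

noncomputable instance : SMul K (LeavittPathAlgebra K V) where
  smul k := Quotient.map' (k • ·) fun _ _ h => leavittCon_smul K k h

theorem mk_smul (k : K) (a : FreeAlg K V) : mk (k • a) = k • mk a := rfl

noncomputable instance : Module K (LeavittPathAlgebra K V) :=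
  Function.Surjective.module K (⟨⟨mk, rfl⟩, mk_add⟩ : FreeAlg K V →+ LeavittPathAlgebra K V)
    mk_surjective mk_smul

instance : IsScalarTower K (LeavittPathAlgebra K V) (LeavittPathAlgebra K V) where
  smul_assoc k x y := by
    obtain ⟨a, rfl⟩ := mk_surjective x
    obtain ⟨b, rfl⟩ := mk_surjective y
    simp only [smul_eq_mul, ← mk_smul, ← mk_mul, smul_mul_assoc]

instance : SMulCommClass K (LeavittPathAlgebra K V) (LeavittPathAlgebra K V) where
  smul_comm k x y := by
    obtain ⟨a, rfl⟩ := mk_surjective x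
    obtain ⟨b, rfl⟩ := mk_surjective y
    simp only [smul_eq_mul, ← mk_smul, ← mk_mul, mul_smul_comm]

/-- A vertex as an element of the Leavitt path algebra. -/
noncomputable def vertex (K : Type*) [Field K] {V : Type*} [Quiver V] (v : V) :
    LeavittPathAlgebra K V := mk (fv K v)

/-- An edge as an element of the Leavitt path algebra. -/
noncomputable def edge (K : Type*) [Field K] {V : Type*} [Quiver V] (e : Quiver.Total V) :
    LeavittPathAlgebra K V := mk (fe K e)

/-- A ghost edge as an element of the Leavitt path algebra. -/
noncomputable def ghost (K : Type*) [Field K] {V : Type*} [Quiver V] (e : Quiver.Total V) :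
    LeavittPathAlgebra K V := mk (fg K e)

/-- The two-sided ideal `I(X)` of the Leavitt path algebra generated by a set of vertices. -/
noncomputable def vertexIdeal (K : Type*) [Field K] {V : Type*} [Quiver V] (X : Set V) :
    TwoSidedIdeal (LeavittPathAlgebra K V) :=
  TwoSidedIdeal.span (vertex K '' X)

end LeavittPathAlgebra

/-- `I`, viewed as a right ideal of the (possibly non-unital) ring `R`, is dense: for all
`x ≠ 0` and `y` in `R` some `r` in `R` satisfies `x r ≠ 0` and `y r ∈ I`. -/
def IsDenseRight {R : Type*} [NonUnitalRing R] (I : TwoSidedIdeal R) : Prop :=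
  ∀ x y : R, x ≠ 0 → ∃ r : R, x * r ≠ 0 ∧ y * r ∈ I

/-- `I`, viewed as a left ideal of the (possibly non-unital) ring `R`, is dense: for all
`x ≠ 0` and `y` in `R` some `r` in `R` satisfies `r x ≠ 0` and `r y ∈ I`. -/
def IsDenseLeft {R : Type*} [NonUnitalRing R] (I : TwoSidedIdeal R) : Prop :=
  ∀ x y : R, x ≠ 0 → ∃ r : R, r * x ≠ 0 ∧ r * y ∈ I

end LPA

/-!
Write `L` for the Leavitt path algebra, `I` for the ideal generated by the hereditary set `H`, and
`e*`, `p*` for ghost edges and ghost paths.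

Suppose that `v` does not connect to `H`. A monomial `p q*` in `w L v` with `w ∈ H` has `p`
starting in `H`, hence ending in `H`, and `q` starting at `v` with the same end; so there is none,
`w L v = 0` (`vertex_mul_mul_vertex_eq_zero`), and `I v = 0`. As `v ≠ 0`, no `r` has `r v ≠ 0` and
`r v ∈ I`, and `I` is not dense.

Conversely, suppose that every vertex connects to `H`. It is enough to find `w ∈ H` and `a` with
`w a x ≠ 0` for each `x ≠ 0`, for then `r = w a` lies in `I`
(`eq_zero_of_forall_vertex_mul_mul`). This is proved by induction on the length of the real paths
`p` in the monomials `p q*` of `x`, since multiplication by `e*` on the left shortens them. If all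
products `e* x` vanish, (CK2) gives `v x = 0` for each regular vertex `v`; for a sink or an
infinite emitter `v`, the problem reduces to the case of a combination of ghost paths `q*`
with `q` ending at `v`. For a path `p` from `v` to `w ∈ H`, left multiplication by `p*` carries
these ghost paths to the distinct ghost paths `(q p)*`. So what is needed is that ghost paths with a
common range are linearly independent (`linearIndependent_ghostPath`); this is read off from a
representation of `L` on the functions on a graded branching system, and it contains the fact that
vertices are not zero in `L`.

The assertion on right ideals follows by means of the involution that exchanges `e` and `e*`.
-/

namespace LPA

/-! ### Generators and relations -/

/-- A Leavitt family for the graph on `V` in a `K`-algebra `A`: elements `P v`, `S e`, `T e` of `A`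
that satisfy the defining relations of the Leavitt path algebra in the roles of the vertices,
edges and ghost edges. -/
structure LeavittFamily {V : Type*} [Quiver V] {A : Type*} [NonUnitalRing A]
    (P : V → A) (S T : Quiver.Total V → A) : Prop where
  vertex_self : ∀ v, P v * P v = P v
  vertex_ne : ∀ v w, v ≠ w → P v * P w = 0
  source_edge : ∀ e, P e.left * S e = S e
  edge_range : ∀ e, S e * P e.right = S e
  range_ghost : ∀ e, P e.right * T e = T e
  ghost_source : ∀ e, T e * P e.left = T e
  ck1_self : ∀ e, T e * S e = P e.right
  ck1_ne : ∀ e f, e ≠ f → T e * S f = 0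
  ck2 : ∀ v (h : IsRegular v), P v = ∑ e ∈ h.2.toFinset, S e * T e

namespace LeavittPathAlgebra

variable {K : Type*} [Field K] {V : Type*} [Quiver V]

theorem mk_eq_of_rel {a b : FreeAlg K V} (h : Rel K a b) : mk a = mk b :=
  (RingCon.eq _).2 fun _ hc => hc.1 a b h

/-- The quotient map as a homomorphism of `K`-algebras. -/
noncomputable def mkHom : FreeAlg K V →ₙₐ[K] LeavittPathAlgebra K V where
  toFun := mk
  map_smul' := mk_smul
  map_zero' := rfl
  map_add' := mk_add
  map_mul' := mk_mul

theorem leavittFamily :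
    LeavittFamily (vertex K : V → LeavittPathAlgebra K V) (edge K) (ghost K) where
  vertex_self v := mk_eq_of_rel (.vertex_self v)
  vertex_ne v w h := mk_eq_of_rel (.vertex_ne v w h)
  source_edge e := mk_eq_of_rel (.source_edge e)
  edge_range e := mk_eq_of_rel (.edge_range e)
  range_ghost e := mk_eq_of_rel (.range_ghost e)
  ghost_source e := mk_eq_of_rel (.ghost_source e)
  ck1_self e := mk_eq_of_rel (.ck1_self e)
  ck1_ne e f h := mk_eq_of_rel (.ck1_ne e f h)
  ck2 v h := (mk_eq_of_rel (.ck2 v h)).trans (map_sum mkHom _ _)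

section Relations

variable (K)

theorem vertex_mul_vertex (v : V) : vertex K v * vertex K v = vertex K v :=
  leavittFamily.vertex_self v

theorem vertex_mul_vertex_of_ne {v w : V} (h : v ≠ w) : vertex K v * vertex K w = 0 :=
  leavittFamily.vertex_ne v w h

theorem vertex_mul_edge (e : Quiver.Total V) : vertex K e.left * edge K e = edge K e :=
  leavittFamily.source_edge e

theorem edge_mul_vertex (e : Quiver.Total V) : edge K e * vertex K e.right = edge K e :=
  leavittFamily.edge_range e

theorem vertex_mul_ghost (e : Quiver.Total V) : vertex K e.right * ghost K e = ghost K e :=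
  leavittFamily.range_ghost e

theorem ghost_mul_vertex (e : Quiver.Total V) : ghost K e * vertex K e.left = ghost K e :=
  leavittFamily.ghost_source e

theorem ghost_mul_edge (e : Quiver.Total V) : ghost K e * edge K e = vertex K e.right :=
  leavittFamily.ck1_self e

theorem ghost_mul_edge_of_ne {e f : Quiver.Total V} (h : e ≠ f) : ghost K e * edge K f = 0 :=
  leavittFamily.ck1_ne e f h

theorem vertex_mul_edge_of_ne {v : V} {e : Quiver.Total V} (h : v ≠ e.left) :
    vertex K v * edge K e = 0 := by
  rw [← vertex_mul_edge, ← mul_assoc, vertex_mul_vertex_of_ne K h, zero_mul]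

theorem ghost_mul_vertex_of_ne {v : V} {e : Quiver.Total V} (h : e.left ≠ v) :
    ghost K e * vertex K v = 0 := by
  rw [← ghost_mul_vertex, mul_assoc, vertex_mul_vertex_of_ne K h, mul_zero]

end Relations

/-- The Leavitt path algebra is spanned by words in the generators, so it is exhausted by a
subspace that contains the generators and is closed under left multiplication by them. -/
theorem mem_of_generators (D : Submodule K (LeavittPathAlgebra K V))
    (hv : ∀ v, vertex K v ∈ D) (he : ∀ e, edge K e ∈ D) (hg : ∀ e, ghost K e ∈ D)
    (hv' : ∀ v, ∀ y ∈ D, vertex K v * y ∈ D) (he' : ∀ e, ∀ y ∈ D, edge K e * y ∈ D)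
    (hg' : ∀ e, ∀ y ∈ D, ghost K e * y ∈ D) (x : LeavittPathAlgebra K V) : x ∈ D := by
  obtain ⟨a, rfl⟩ := mk_surjective x
  have hword : ∀ m : FreeSemigroup (Gen V), mkHom (MonoidAlgebra.single m (1 : K)) ∈ D := by
    intro m
    induction m using FreeSemigroup.recOnMul with
    | ih1 g => cases g with
      | vertex v => exact hv v
      | edge e => exact he e
      | ghost e => exact hg e
    | ih2 g m _ ih =>
      have h : (MonoidAlgebra.single (FreeSemigroup.of g * m) (1 : K)) =
          MonoidAlgebra.single (FreeSemigroup.of g) 1 * MonoidAlgebra.single m 1 := by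
        rw [MonoidAlgebra.single_mul_single, one_mul]
      rw [h, map_mul]
      cases g with
      | vertex v => exact hv' v _ ih
      | edge e => exact he' e _ ih
      | ghost e => exact hg' e _ ih
  change mkHom a ∈ D
  induction a using MonoidAlgebra.induction_linear with
  | zero => rw [map_zero]; exact D.zero_mem
  | add f g hf hg => rw [map_add]; exact D.add_mem hf hg
  | single m k =>
    rw [← mul_one k, ← smul_eq_mul, ← MonoidAlgebra.smul_single, map_smul]
    exact D.smul_mem k (hword m)

/-- The universal property of the Leavitt path algebra. -/
theorem exists_lift {A : Type*} [NonUnitalRing A] [Module K A] [IsScalarTower K A A]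
    [SMulCommClass K A A] {P : V → A} {S T : Quiver.Total V → A} (hf : LeavittFamily P S T) :
    ∃ F : LeavittPathAlgebra K V →ₙₐ[K] A, (∀ v, F (vertex K v) = P v) ∧
      (∀ e, F (edge K e) = S e) ∧ ∀ e, F (ghost K e) = T e := by
  let gen : Gen V → A := fun g => match g with
    | .vertex v => P v
    | .edge e => S e
    | .ghost e => T e
  let f : FreeAlg K V →ₙₐ[K] A := MonoidAlgebra.liftMagma K (FreeSemigroup.lift gen)
  have hgen : ∀ g, f (MonoidAlgebra.single (FreeSemigroup.of g) 1) = gen g := by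
    intro g
    simp [f]
  have hfv : ∀ v, f (fv K v) = P v := fun v => hgen (.vertex v)
  have hfe : ∀ e, f (fe K e) = S e := fun e => hgen (.edge e)
  have hfg : ∀ e, f (fg K e) = T e := fun e => hgen (.ghost e)
  let c : RingCon (FreeAlg K V) :=
    { r := fun a b => f a = f b
      iseqv := ⟨fun _ => rfl, fun h => h.symm, fun h h' => h.trans h'⟩
      mul' := fun {w x y z} (h : f w = f x) (h' : f y = f z) => by
        rw [map_mul, map_mul, h, h']
      add' := fun {w x y z} (h : f w = f x) (h' : f y = f z) => by
        rw [map_add, map_add, h, h'] }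
  have hrel : ∀ a b, Rel K a b → f a = f b := by
    intro a b h
    induction h with
    | vertex_self v => simp only [map_mul, hfv, hf.vertex_self]
    | vertex_ne v w h => simp only [map_mul, map_zero, hfv, hf.vertex_ne v w h]
    | source_edge e => simp only [map_mul, hfv, hfe, hf.source_edge]
    | edge_range e => simp only [map_mul, hfv, hfe, hf.edge_range]
    | range_ghost e => simp only [map_mul, hfv, hfg, hf.range_ghost]
    | ghost_source e => simp only [map_mul, hfv, hfg, hf.ghost_source]
    | ck1_self e => simp only [map_mul, hfv, hfe, hfg, hf.ck1_self]
    | ck1_ne e e' h => simp only [map_mul, map_zero, hfe, hfg, hf.ck1_ne e e' h]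
    | ck2 v h => simp only [map_sum, map_mul, hfv, hfe, hfg, hf.ck2 v h]
  have hc : ∀ a b, leavittCon K V a b → f a = f b := fun a b h =>
    h c ⟨hrel, fun k a b (h : f a = f b) => by
      change f (k • a) = f (k • b)
      rw [map_smul, map_smul, h]⟩
  let F : LeavittPathAlgebra K V → A := Quotient.lift f hc
  have hF : ∀ a, F (mk a) = f a := fun _ => rfl
  refine ⟨⟨⟨⟨F, ?_⟩, ?_, ?_⟩, ?_⟩, hfv, hfe, hfg⟩
  · intro k x
    obtain ⟨a, rfl⟩ := mk_surjective x
    exact map_smul f k a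
  · exact map_zero f
  · intro x y
    obtain ⟨a, rfl⟩ := mk_surjective x
    obtain ⟨b, rfl⟩ := mk_surjective y
    exact map_add f a b
  · intro x y
    obtain ⟨a, rfl⟩ := mk_surjective x
    obtain ⟨b, rfl⟩ := mk_surjective y
    exact map_mul f a b

open MulOpposite in
/-- The involution of the Leavitt path algebra, which fixes the vertices and exchanges `e` with
`e*`; it turns statements about left ideals into statements about right ideals. -/
theorem exists_involution : ∃ σ : LeavittPathAlgebra K V → LeavittPathAlgebra K V,
    (∀ x y, σ (x * y) = σ y * σ x) ∧ (∀ x, σ (σ x) = x) ∧ σ 0 = 0 ∧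
      ∀ v, σ (vertex K v) = vertex K v := by
  have hfam : LeavittFamily (fun v : V => op (vertex K v))
      (fun e => op (ghost K e)) (fun e => op (edge K e)) := by
    constructor
    · intro v
      rw [← op_mul, vertex_mul_vertex]
    · intro v w h
      rw [← op_mul, vertex_mul_vertex_of_ne K h.symm, op_zero]
    · intro e
      rw [← op_mul, ghost_mul_vertex]
    · intro e
      rw [← op_mul, vertex_mul_ghost]
    · intro e
      rw [← op_mul, edge_mul_vertex]
    · intro e
      rw [← op_mul, vertex_mul_edge]
    · intro e
      rw [← op_mul, ghost_mul_edge]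
    · intro e f h
      rw [← op_mul, ghost_mul_edge_of_ne K h.symm, op_zero]
    · intro v h
      rw [leavittFamily.ck2 v h, Finset.op_sum]
      simp only [op_mul]
  obtain ⟨F, hv, he, hg⟩ := exists_lift (K := K) hfam
  let φ : LeavittPathAlgebra K V →ₗ[K] LeavittPathAlgebra K V :=
    (opLinearEquiv K).symm.toLinearMap ∘ₗ
      (F : LeavittPathAlgebra K V →ₗ[K] (LeavittPathAlgebra K V)ᵐᵒᵖ)
  have hφ : ∀ x, φ x = (F x).unop := fun _ => rfl
  have hφmul : ∀ x y, φ (x * y) = φ y * φ x := fun x y => by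
    simp only [hφ, map_mul, MulOpposite.unop_mul]
  have hφv : ∀ v, φ (vertex K v) = vertex K v := fun v => by simp only [hφ, hv, MulOpposite.unop_op]
  have hφe : ∀ e, φ (edge K e) = ghost K e := fun e => by simp only [hφ, he, MulOpposite.unop_op]
  have hφg : ∀ e, φ (ghost K e) = edge K e := fun e => by simp only [hφ, hg, MulOpposite.unop_op]
  refine ⟨φ, hφmul, fun x => ?_, map_zero φ, hφv⟩
  have hx : x ∈ LinearMap.eqLocus (φ ∘ₗ φ) LinearMap.id := by
    refine mem_of_generators _ ?_ ?_ ?_ ?_ ?_ ?_ x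
    · intro v
      simp [hφv]
    · intro e
      simp [hφe, hφg]
    · intro e
      simp [hφe, hφg]
    · intro v y hy
      simp only [LinearMap.mem_eqLocus, LinearMap.comp_apply, LinearMap.id_apply] at hy ⊢
      rw [hφmul, hφmul, hy, hφv, hφv]
    · intro e y hy
      simp only [LinearMap.mem_eqLocus, LinearMap.comp_apply, LinearMap.id_apply] at hy ⊢
      rw [hφmul, hφmul, hy, hφe, hφg]
    · intro e y hy
      simp only [LinearMap.mem_eqLocus, LinearMap.comp_apply, LinearMap.id_apply] at hy ⊢
      rw [hφmul, hφmul, hy, hφg, hφe]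
  exact hx

open Classical in
/-- The finite sums of vertices are local units. -/
theorem exists_local_unit (x : LeavittPathAlgebra K V) :
    ∃ F : Finset V, ∀ F', F ⊆ F' → ∑ v ∈ F', vertex K v * x = x := by
  have hsingle : ∀ (v : V) (y : LeavittPathAlgebra K V), vertex K v * y = y →
      ∃ F : Finset V, ∀ F', F ⊆ F' → ∑ u ∈ F', vertex K u * y = y := by
    intro v y hy
    refine ⟨{v}, fun F' hF' => ?_⟩
    rw [Finset.sum_eq_single v, hy]
    · intro u _ hu
      rw [← hy, ← mul_assoc, vertex_mul_vertex_of_ne K hu, zero_mul]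
    · exact fun h => absurd (hF' (Finset.mem_singleton_self v)) h
  let D : Submodule K (LeavittPathAlgebra K V) :=
    { carrier := {x | ∃ F : Finset V, ∀ F', F ⊆ F' → ∑ v ∈ F', vertex K v * x = x}
      zero_mem' := ⟨∅, fun F' _ => by simp⟩
      add_mem' := by
        rintro a b ⟨F, hF⟩ ⟨G, hG⟩
        refine ⟨F ∪ G, fun F' hF' => ?_⟩
        simp only [mul_add, Finset.sum_add_distrib]
        rw [hF F' (Finset.union_subset_left hF'), hG F' (Finset.union_subset_right hF')]
      smul_mem' := by
        rintro k a ⟨F, hF⟩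
        refine ⟨F, fun F' hF' => ?_⟩
        simp only [mul_smul_comm]
        rw [← Finset.smul_sum, hF F' hF'] }
  have hx : x ∈ D := by
    refine mem_of_generators D (fun v => hsingle v _ (vertex_mul_vertex K v))
      (fun e => hsingle e.left _ (vertex_mul_edge K e))
      (fun e => hsingle e.right _ (vertex_mul_ghost K e))
      (fun v y _ => hsingle v _ ?_) (fun e y _ => hsingle e.left _ ?_)
      (fun e y _ => hsingle e.right _ ?_) x
    · rw [← mul_assoc, vertex_mul_vertex]
    · rw [← mul_assoc, vertex_mul_edge]
    · rw [← mul_assoc, vertex_mul_ghost]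
  exact hx

theorem eq_zero_of_forall_vertex_mul {x : LeavittPathAlgebra K V}
    (h : ∀ v, vertex K v * x = 0) : x = 0 := by
  obtain ⟨F, hF⟩ := exists_local_unit x
  rw [← hF F subset_rfl]
  exact Finset.sum_eq_zero fun v _ => h v

end LeavittPathAlgebra

/-! ### A graded representation and the independence of ghost paths -/

/-- A graded branching system over the graph on `V`: a set `A` of would-be "boundary paths" with
a source and possibly a first edge, together with the operations of prepending an edge and of
removing the first edge. A point whose source is a regular vertex has a first edge. The degree
counts the edges prepended. The point `tail a` is meaningless if `head a = none`, and so is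
`cons e a` if `src a ≠ e.right`; the axioms that hold for it then are merely convenient. -/
structure BranchingSystem (V : Type*) [Quiver V] (A : Type*) where
  src : A → V
  head : A → Option (Quiver.Total V)
  tail : A → A
  cons : Quiver.Total V → A → A
  deg : A → ℤ
  src_cons : ∀ e a, src (cons e a) = e.left
  head_cons : ∀ e a, head (cons e a) = some e
  tail_cons : ∀ e a, src a = e.right → tail (cons e a) = a
  src_of_head : ∀ e a, head a = some e → src a = e.left
  src_tail : ∀ e a, head a = some e → src (tail a) = e.right
  cons_tail : ∀ e a, head a = some e → cons e (tail a) = a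
  head_ne_none : ∀ a, IsRegular (src a) → head a ≠ none
  deg_cons : ∀ e a, deg (cons e a) = deg a + 1

open Cardinal in
/-- Take `V × X × ℤ` for an infinite set `X` with at least as many elements as there are edges,
and for each vertex `v` that is not a sink a bijection `s⁻¹(v) × X ≃ X`. -/
theorem exists_branchingSystem.{u₁, u₂} (V : Type u₁) [Quiver.{u₂} V] :
    ∃ (A : Type max u₁ u₂) (B : BranchingSystem V A), ∀ v, ∃ a, B.src a = v := by
  classical
  let X := ℕ ⊕ Quiver.Total V
  have hX : ∀ v : V, (outEdges v).Nonempty → Nonempty (outEdges v × X ≃ X) := by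
    intro v hv
    refine Cardinal.eq.1 ?_
    rw [← Cardinal.mul_def]
    refine Cardinal.mul_eq_right (Cardinal.aleph0_le_mk X) ?_ ?_
    · exact (Cardinal.mk_set_le _).trans (Cardinal.mk_le_of_injective (f := Sum.inr)
        Sum.inr_injective)
    · have := hv.to_subtype
      exact Cardinal.mk_ne_zero _
  have σ := fun v hv => Classical.choice (hX v hv)
  have hne : ∀ e : Quiver.Total V, (outEdges e.left).Nonempty := fun e => ⟨e, rfl⟩
  -- The inverse of `σ v`, with value `none` at the sinks `v`, where there is no `σ v`.
  let dec : V → X → Option (Quiver.Total V × X) := fun v s =>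
    if h : (outEdges v).Nonempty then
      some ((((σ v h).symm s).1 : Quiver.Total V), ((σ v h).symm s).2) else none
  let enc : Quiver.Total V → X → X := fun e s => σ e.left (hne e) (⟨e, rfl⟩, s)
  have hdec_enc : ∀ e s, dec e.left (enc e s) = some (e, s) := by
    intro e s
    simp [dec, enc, hne e]
  have hdec : ∀ v s e t, dec v s = some (e, t) → e.left = v ∧ enc e t = s := by
    intro v s e t h
    by_cases hv : (outEdges v).Nonempty
    · simp only [dec, hv, dif_pos, Option.some.injEq, Prod.mk.injEq] at h
      obtain ⟨h1, h2⟩ := h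
      have h3 : e.left = v := by
        rw [← h1]
        exact ((σ v hv).symm s).1.2
      subst h3
      refine ⟨rfl, ?_⟩
      have h4 : ((⟨e, rfl⟩, t) : outEdges e.left × X) = (σ e.left hv).symm s :=
        Prod.ext (Subtype.ext h1.symm) h2.symm
      change σ e.left hv (⟨e, rfl⟩, t) = s
      rw [h4, Equiv.apply_symm_apply]
    · simp [dec, hv] at h
  refine ⟨V × X × ℤ,
    { src := fun a => a.1
      head := fun a => (dec a.1 a.2.1).map Prod.fst
      tail := fun a => match dec a.1 a.2.1 with
        | some (e, t) => (e.right, t, a.2.2 - 1)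
        | none => a
      cons := fun e a => (e.left, enc e a.2.1, a.2.2 + 1)
      deg := fun a => a.2.2
      src_cons := fun e a => rfl
      head_cons := fun e a => by simp [hdec_enc]
      tail_cons := ?_
      src_of_head := ?_
      src_tail := ?_
      cons_tail := ?_
      head_ne_none := ?_
      deg_cons := fun e a => rfl }, fun v => ⟨(v, Sum.inl 0, 0), rfl⟩⟩
  · rintro e ⟨v, s, d⟩ (rfl : v = e.right)
    simp [hdec_enc]
  · rintro e ⟨v, s, d⟩ h
    obtain ⟨⟨e', t⟩, h1, rfl⟩ := Option.map_eq_some_iff.1 h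
    exact (hdec _ _ _ _ h1).1.symm
  · rintro e ⟨v, s, d⟩ h
    obtain ⟨⟨e', t⟩, h1, rfl⟩ := Option.map_eq_some_iff.1 h
    simp only at h1
    simp [h1]
  · rintro e ⟨v, s, d⟩ h
    obtain ⟨⟨e', t⟩, h1, rfl⟩ := Option.map_eq_some_iff.1 h
    simp only at h1
    obtain ⟨rfl, h2⟩ := hdec _ _ _ _ h1
    simp [h1, h2]
  · rintro ⟨v, s, d⟩ h
    have hv : (outEdges v).Nonempty := h.1
    simp [dec, hv]

namespace BranchingSystem

variable {V : Type*} [Quiver V] {A : Type*} (B : BranchingSystem V A)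

/-- Prepending a path to a point of a branching system. -/
def prepend {u v : V} (p : Quiver.Path u v) : A → A :=
  match p with
  | .nil => id
  | .cons q f => fun a => prepend q (B.cons ⟨_, _, f⟩ a)

theorem deg_prepend {u v : V} (p : Quiver.Path u v) (a : A) :
    B.deg (B.prepend p a) = B.deg a + p.length := by
  induction p generalizing a with
  | nil => simp [prepend]
  | cons q f ih =>
    simp only [prepend, ih, B.deg_cons, Quiver.Path.length_cons]
    push_cast
    ring

theorem src_prepend {u v : V} (p : Quiver.Path u v) {a : A} (ha : B.src a = v) :
    B.src (B.prepend p a) = u := by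
  induction p generalizing a with
  | nil => exact ha
  | cons q f ih => exact ih (B.src_cons _ _)

/-- Two paths of the same length are read off from the points that they are prepended to. The
ends `v` and `v'` are not assumed equal, as the induction removes the last edges, whose sources are
not known to agree beforehand. -/
theorem prepend_injective {u v v' : V} (p : Quiver.Path u v) (q : Quiver.Path u v') {a b : A}
    (ha : B.src a = v) (hb : B.src b = v') (hl : p.length = q.length)
    (h : B.prepend p a = B.prepend q b) :
    (⟨v, p⟩ : Σ w, Quiver.Path u w) = ⟨v', q⟩ ∧ a = b := by
  induction p generalizing v' a b with
  | nil => cases q with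
    | nil => exact ⟨rfl, h⟩
    | cons q f => simp at hl
  | cons p f ih => cases q with
    | nil => simp at hl
    | cons q g =>
      obtain ⟨h1, h2⟩ := ih q (B.src_cons _ _) (B.src_cons _ _) (by simpa using hl) h
      have h3 := congrArg B.head h2
      have h4 := congrArg B.tail h2
      rw [B.head_cons, B.head_cons] at h3
      rw [B.tail_cons _ _ ha, B.tail_cons _ _ hb] at h4
      refine ⟨?_, h4⟩
      simp only [Option.some.injEq, Quiver.Total.mk.injEq] at h3
      obtain ⟨rfl, rfl, hfg⟩ := h3
      obtain rfl := eq_of_heq hfg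
      obtain rfl := eq_of_heq (Sigma.mk.inj h1).2
      rfl

open Classical in
/-- The Leavitt path algebra acts on the functions on a branching system: a vertex restricts a
function to the points with that source, an edge `e` transports it along `cons e`, and `e*`
pulls it back along `cons e`. -/
theorem exists_representation (K : Type*) [Field K] :
    ∃ F : LeavittPathAlgebra K V →ₙₐ[K] Module.End K (A → K),
      (∀ v φ a, F (LeavittPathAlgebra.vertex K v) φ a = if B.src a = v then φ a else 0) ∧
      ∀ e φ a, F (LeavittPathAlgebra.ghost K e) φ a =
        if B.src a = e.right then φ (B.cons e a) else 0 := by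
  let P : V → Module.End K (A → K) := fun v =>
    { toFun := fun φ a => if B.src a = v then φ a else 0
      map_add' := fun φ ψ => by ext a; by_cases h : B.src a = v <;> simp [h]
      map_smul' := fun k φ => by ext a; by_cases h : B.src a = v <;> simp [h] }
  let S : Quiver.Total V → Module.End K (A → K) := fun e =>
    { toFun := fun φ a => if B.head a = some e then φ (B.tail a) else 0
      map_add' := fun φ ψ => by ext a; by_cases h : B.head a = some e <;> simp [h]
      map_smul' := fun k φ => by ext a; by_cases h : B.head a = some e <;> simp [h] }
  let T : Quiver.Total V → Module.End K (A → K) := fun e =>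
    { toFun := fun φ a => if B.src a = e.right then φ (B.cons e a) else 0
      map_add' := fun φ ψ => by ext a; by_cases h : B.src a = e.right <;> simp [h]
      map_smul' := fun k φ => by ext a; by_cases h : B.src a = e.right <;> simp [h] }
  have hP : ∀ v φ a, P v φ a = if B.src a = v then φ a else 0 := fun _ _ _ => rfl
  have hS : ∀ e φ a, S e φ a = if B.head a = some e then φ (B.tail a) else 0 := fun _ _ _ => rfl
  have hT : ∀ e φ a, T e φ a = if B.src a = e.right then φ (B.cons e a) else 0 :=
    fun _ _ _ => rfl
  have hST : ∀ e φ a, S e (T e φ) a = if B.head a = some e then φ a else 0 := by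
    intro e φ a
    rw [hS, hT]
    by_cases h : B.head a = some e
    · rw [if_pos h, if_pos h, if_pos (B.src_tail _ _ h), B.cons_tail _ _ h]
    · rw [if_neg h, if_neg h]
  have hfam : LeavittFamily P S T := by
    constructor
    · intro v
      ext φ a
      by_cases h : B.src a = v <;> simp [Module.End.mul_apply, hP, h]
    · intro v w hvw
      ext φ a
      by_cases h : B.src a = v
      · have h' : B.src a ≠ w := fun h' => hvw (h.symm.trans h')
        simp [Module.End.mul_apply, hP, h']
      · simp [Module.End.mul_apply, hP, h]
    · intro e
      ext φ a
      by_cases h : B.head a = some e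
      · simp [Module.End.mul_apply, hP, hS, h, B.src_of_head _ _ h]
      · simp [Module.End.mul_apply, hP, hS, h]
    · intro e
      ext φ a
      by_cases h : B.head a = some e
      · simp [Module.End.mul_apply, hP, hS, h, B.src_tail _ _ h]
      · simp [Module.End.mul_apply, hS, h]
    · intro e
      ext φ a
      by_cases h : B.src a = e.right <;> simp [Module.End.mul_apply, hP, hT, h]
    · intro e
      ext φ a
      by_cases h : B.src a = e.right <;> simp [Module.End.mul_apply, hP, hT, h, B.src_cons]
    · intro e
      ext φ a
      by_cases h : B.src a = e.right
      · simp [Module.End.mul_apply, hP, hS, hT, h, B.head_cons, B.tail_cons]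
      · simp [Module.End.mul_apply, hP, hT, h]
    · intro e f hef
      ext φ a
      simp [Module.End.mul_apply, hS, hT, B.head_cons, hef]
    · intro v hv
      ext φ a
      rw [hP, LinearMap.sum_apply, Finset.sum_apply]
      simp only [Module.End.mul_apply, hST]
      by_cases h : B.src a = v
      · subst h
        obtain ⟨f, hf⟩ := Option.ne_none_iff_exists'.1 (B.head_ne_none a hv)
        rw [if_pos rfl, Finset.sum_eq_single f, if_pos hf]
        · intro e _ he
          rw [if_neg]
          rw [hf]
          exact fun h => he (Option.some.inj h).symm
        · intro h
          refine absurd ?_ h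
          rw [Set.Finite.mem_toFinset]
          exact (B.src_of_head _ _ hf).symm
      · rw [if_neg h, Finset.sum_eq_zero]
        intro e he
        rw [if_neg]
        intro h'
        rw [Set.Finite.mem_toFinset] at he
        exact h ((B.src_of_head _ _ h').trans he)
  obtain ⟨F, hv, -, hg⟩ := LeavittPathAlgebra.exists_lift (K := K) hfam
  exact ⟨F, fun v φ a => by rw [hv, hP], fun e φ a => by rw [hg, hT]⟩

end BranchingSystem

namespace LeavittPathAlgebra

variable {K : Type*} [Field K] {V : Type*} [Quiver V]

/-- The ghost path `p*` of a path `p`; for `p = e₁ ⋯ eₙ` it is `eₙ* ⋯ e₁*`. -/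
noncomputable def ghostPath (K : Type*) [Field K] {V : Type*} [Quiver V] {u v : V} :
    Quiver.Path u v → LeavittPathAlgebra K V
  | .nil => vertex K u
  | .cons q f => ghost K ⟨_, _, f⟩ * ghostPath K q

theorem vertex_mul_ghostPath {u v : V} (p : Quiver.Path u v) :
    vertex K v * ghostPath K p = ghostPath K p := by
  cases p with
  | nil => exact vertex_mul_vertex K u
  | cons q f =>
    rw [ghostPath, ← mul_assoc]
    exact congrArg (· * _) (vertex_mul_ghost K ⟨_, _, f⟩)

theorem ghostPath_mul_vertex {u v : V} (p : Quiver.Path u v) :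
    ghostPath K p * vertex K u = ghostPath K p := by
  induction p with
  | nil => exact vertex_mul_vertex K u
  | cons q f ih => rw [ghostPath, mul_assoc, ih]

theorem vertex_mul_ghostPath_of_ne {u v w : V} (h : w ≠ v) (p : Quiver.Path u v) :
    vertex K w * ghostPath K p = 0 := by
  rw [← vertex_mul_ghostPath, ← mul_assoc, vertex_mul_vertex_of_ne K h, zero_mul]

theorem ghostPath_mul_vertex_of_ne {u v w : V} (h : u ≠ w) (p : Quiver.Path u v) :
    ghostPath K p * vertex K w = 0 := by
  rw [← ghostPath_mul_vertex, mul_assoc, vertex_mul_vertex_of_ne K h, mul_zero]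

theorem ghostPath_comp {u v w : V} (p : Quiver.Path u v) (q : Quiver.Path v w) :
    ghostPath K (p.comp q) = ghostPath K q * ghostPath K p := by
  induction q with
  | nil => exact (vertex_mul_ghostPath p).symm
  | cons q f ih => rw [Quiver.Path.comp_cons, ghostPath, ghostPath, ih, mul_assoc]

/-- The ghost paths `p*` for paths `p` ending at `v` are linearly independent: in the
representation on functions on a graded branching system, the value of `p* δ_{q a}` at `a` is
`1` if `p = q` and `0` otherwise. -/
theorem linearIndependent_ghostPath (K : Type*) [Field K] {V : Type*} [Quiver V] (v : V) :
    LinearIndependent K (fun p : Σ u, Quiver.Path u v => ghostPath K p.2) := by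
  classical
  obtain ⟨A, B, hB⟩ := exists_branchingSystem V
  obtain ⟨F, hFv, hFg⟩ := B.exists_representation K
  obtain ⟨a, rfl⟩ := hB v
  have hghost : ∀ {u w : V} (p : Quiver.Path u w) (φ : A → K) (b : A), B.src b = w →
      F (ghostPath K p) φ b = φ (B.prepend p b) := by
    intro u w p φ
    induction p with
    | nil =>
      intro b hb
      rw [ghostPath, hFv, if_pos hb]
      rfl
    | cons q f ih =>
      intro b hb
      rw [ghostPath, map_mul, Module.End.mul_apply, hFg, if_pos hb, ih _ (B.src_cons _ _)]
      rfl
  rw [linearIndependent_iff']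
  intro s g hsum q hq
  have hghost' : ∀ (p : Σ u, Quiver.Path u (B.src a)) (φ : A → K),
      F (ghostPath K p.2) φ a = φ (B.prepend p.2 a) := fun p φ => hghost p.2 φ a rfl
  have h := congrArg (fun x => F x (Pi.single (B.prepend q.2 a) 1) a) hsum
  simp only [map_sum, map_smul, map_zero, LinearMap.sum_apply, Finset.sum_apply,
    LinearMap.smul_apply, Pi.smul_apply, LinearMap.zero_apply, Pi.zero_apply,
    hghost'] at h
  rw [Finset.sum_eq_single q, Pi.single_eq_same] at h
  · simpa using h
  · intro p _ hpq
    rw [Pi.single_eq_of_ne, smul_zero]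
    intro heq
    refine hpq ?_
    obtain ⟨u, p⟩ := p
    obtain ⟨u', q⟩ := q
    obtain rfl : u = u' := by
      rw [← B.src_prepend p rfl, heq, B.src_prepend q rfl]
    have hl : p.length = q.length := by
      have hd := congrArg B.deg heq
      rw [B.deg_prepend, B.deg_prepend] at hd
      exact_mod_cast add_left_cancel hd
    have := (B.prepend_injective p q rfl rfl hl heq).1
    rw [eq_of_heq (Sigma.mk.inj this).2]
  · exact fun h => absurd hq h

theorem vertex_ne_zero (v : V) : vertex K v ≠ 0 :=
  (linearIndependent_ghostPath K v).ne_zero (⟨v, .nil⟩ : Σ u, Quiver.Path u v)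

/-! ### A filtration of the Leavitt path algebra -/

/-- The span of the ghost paths `p*` for paths `p` ending at `v`. -/
noncomputable def ghostSpanAt (K : Type*) [Field K] {V : Type*} [Quiver V] (v : V) :
    Submodule K (LeavittPathAlgebra K V) :=
  Submodule.span K (Set.range fun p : Σ u, Quiver.Path u v => ghostPath K p.2)

/-- The span of all ghost paths, the vertices included. -/
noncomputable def ghostSpan (K : Type*) [Field K] (V : Type*) [Quiver V] :
    Submodule K (LeavittPathAlgebra K V) :=
  ⨆ v, ghostSpanAt K v

theorem ghostSpanAt_le (v : V) : ghostSpanAt K v ≤ ghostSpan K V := le_iSup (ghostSpanAt K) v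

theorem ghostPath_mem {u v : V} (p : Quiver.Path u v) : ghostPath K p ∈ ghostSpanAt K v :=
  Submodule.subset_span ⟨⟨u, p⟩, rfl⟩

theorem ghostSpan_induction {D : Submodule K (LeavittPathAlgebra K V)}
    (h : ∀ {u v : V} (p : Quiver.Path u v), ghostPath K p ∈ D) : ghostSpan K V ≤ D :=
  iSup_le fun _ => Submodule.span_le.2 (Set.range_subset_iff.2 fun p => h p.2)

theorem vertex_mul_mem_ghostSpanAt (v : V) {x : LeavittPathAlgebra K V} (hx : x ∈ ghostSpan K V) :
    vertex K v * x ∈ ghostSpanAt K v := by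
  refine ghostSpan_induction
    (D := (ghostSpanAt K v).comap (LinearMap.mulLeft K (vertex K v))) (fun {u w} p => ?_) hx
  rw [Submodule.mem_comap, LinearMap.mulLeft_apply]
  by_cases h : v = w
  · subst h
    rw [vertex_mul_ghostPath]
    exact ghostPath_mem p
  · rw [vertex_mul_ghostPath_of_ne h]
    exact zero_mem _

theorem ghost_mul_mem_ghostSpan (e : Quiver.Total V) {x : LeavittPathAlgebra K V}
    (hx : x ∈ ghostSpan K V) : ghost K e * x ∈ ghostSpan K V := by
  refine ghostSpan_induction
    (D := (ghostSpan K V).comap (LinearMap.mulLeft K (ghost K e))) (fun {u w} p => ?_) hx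
  rw [Submodule.mem_comap, LinearMap.mulLeft_apply]
  by_cases h : e.left = w
  · subst h
    exact ghostSpanAt_le _ (ghostPath_mem (p.cons e.hom))
  · rw [← vertex_mul_ghostPath, ← mul_assoc, ghost_mul_vertex_of_ne K h, zero_mul]
    exact zero_mem _

/-- Left multiplication by `q*` carries the basis `p*` of `ghostSpanAt K v` to the independent
family `(p q)*`. -/
theorem eq_zero_of_ghostPath_mul {v w : V} (q : Quiver.Path v w) {x : LeavittPathAlgebra K V}
    (hx : x ∈ ghostSpanAt K v) (h : ghostPath K q * x = 0) : x = 0 := by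
  have hli : LinearIndependent K (LinearMap.mulLeft K (ghostPath K q) ∘
      fun p : Σ u, Quiver.Path u v => ghostPath K p.2) := by
    have hinj : Function.Injective
        fun p : Σ u, Quiver.Path u v => (⟨p.1, p.2.comp q⟩ : Σ u, Quiver.Path u w) := by
      rintro ⟨u, p⟩ ⟨u', p'⟩ hp
      obtain ⟨hu, hp⟩ := Sigma.mk.inj hp
      dsimp only at hu hp
      subst hu
      rw [Quiver.Path.comp_injective_left q (eq_of_heq hp)]
    convert (linearIndependent_ghostPath K w).comp _ hinj using 1
    ext p
    exact (ghostPath_comp p.2 q).symm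
  exact Submodule.disjoint_def.1 (Submodule.range_ker_disjoint hli) x hx h

theorem eq_zero_of_ghost_mul (e : Quiver.Total V) {x : LeavittPathAlgebra K V}
    (hx : x ∈ ghostSpanAt K e.left) (h : ghost K e * x = 0) : x = 0 := by
  refine eq_zero_of_ghostPath_mul e.hom.toPath hx ?_
  change ghost K e * vertex K e.left * x = 0
  rw [ghost_mul_vertex, h]

/-- The subspace spanned by the monomials `p q*` in which `p` has length at most `n`. It is
described by recursion on the first edge of `p`. -/
noncomputable def depthFiltration (K : Type*) [Field K] (V : Type*) [Quiver V] :
    ℕ → Submodule K (LeavittPathAlgebra K V)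
  | 0 => ghostSpan K V
  | n + 1 => ghostSpan K V ⊔
      Submodule.span K {x | ∃ e, ∃ y ∈ depthFiltration K V n, x = edge K e * y}

theorem ghostSpan_le_depthFiltration (n : ℕ) : ghostSpan K V ≤ depthFiltration K V n := by
  cases n with
  | zero => exact le_rfl
  | succ n => exact le_sup_left

theorem edge_mul_mem_depthFiltration {n : ℕ} (e : Quiver.Total V) {y : LeavittPathAlgebra K V}
    (hy : y ∈ depthFiltration K V n) : edge K e * y ∈ depthFiltration K V (n + 1) :=
  (le_sup_right : _ ≤ depthFiltration K V (n + 1)) (Submodule.subset_span ⟨e, y, hy, rfl⟩)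

theorem depthFiltration_succ_le {n : ℕ} {D : Submodule K (LeavittPathAlgebra K V)}
    (hg : ghostSpan K V ≤ D) (he : ∀ e, ∀ y ∈ depthFiltration K V n, edge K e * y ∈ D) :
    depthFiltration K V (n + 1) ≤ D := by
  refine sup_le hg (Submodule.span_le.2 ?_)
  rintro _ ⟨e, y, hy, rfl⟩
  exact he e y hy

theorem depthFiltration_mono : Monotone (depthFiltration K V) := by
  refine monotone_nat_of_le_succ fun n => ?_
  induction n with
  | zero => exact ghostSpan_le_depthFiltration 1
  | succ n ih =>
    exact depthFiltration_succ_le (ghostSpan_le_depthFiltration _)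
      fun e y hy => edge_mul_mem_depthFiltration e (ih hy)

theorem vertex_mul_mem_depthFiltration {n : ℕ} (v : V) {x : LeavittPathAlgebra K V}
    (hx : x ∈ depthFiltration K V n) : vertex K v * x ∈ depthFiltration K V n := by
  have hg : ∀ y ∈ ghostSpan K V, vertex K v * y ∈ depthFiltration K V n := fun y hy =>
    ghostSpan_le_depthFiltration n (ghostSpanAt_le v (vertex_mul_mem_ghostSpanAt v hy))
  cases n with
  | zero => exact hg x hx
  | succ n =>
    refine depthFiltration_succ_le
      (D := (depthFiltration K V (n + 1)).comap (LinearMap.mulLeft K (vertex K v)))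
      hg (fun e y hy => ?_) hx
    rw [Submodule.mem_comap, LinearMap.mulLeft_apply, ← mul_assoc]
    by_cases h : v = e.left
    · rw [h, vertex_mul_edge]
      exact edge_mul_mem_depthFiltration e hy
    · rw [vertex_mul_edge_of_ne K h, zero_mul]
      exact zero_mem _

/-- Multiplication by a ghost edge strips the first edge of a monomial `p q*`. -/
theorem ghost_mul_mem_depthFiltration {n : ℕ} (e : Quiver.Total V) {x : LeavittPathAlgebra K V}
    (hx : x ∈ depthFiltration K V (n + 1)) : ghost K e * x ∈ depthFiltration K V n := by
  refine depthFiltration_succ_le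
    (D := (depthFiltration K V n).comap (LinearMap.mulLeft K (ghost K e)))
    (fun y hy => ghostSpan_le_depthFiltration n (ghost_mul_mem_ghostSpan e hy))
    (fun f y hy => ?_) hx
  rw [Submodule.mem_comap, LinearMap.mulLeft_apply, ← mul_assoc]
  by_cases h : e = f
  · subst h
    rw [ghost_mul_edge]
    exact vertex_mul_mem_depthFiltration _ hy
  · rw [ghost_mul_edge_of_ne K h, zero_mul]
    exact zero_mem _

theorem exists_mem_depthFiltration (x : LeavittPathAlgebra K V) :
    ∃ n, x ∈ depthFiltration K V n := by
  have hdir := (depthFiltration_mono (K := K) (V := V)).directed_le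
  have hv : ∀ v, vertex K v ∈ ghostSpan K V := fun v =>
    ghostSpanAt_le v (ghostPath_mem (.nil : Quiver.Path v v))
  have hx : x ∈ ⨆ n, depthFiltration K V n := by
    refine mem_of_generators (⨆ n, depthFiltration K V n) (fun v => ?_) (fun e => ?_) (fun e => ?_)
      (fun v y hy => ?_) (fun e y hy => ?_) (fun e y hy => ?_) x <;>
      simp only [Submodule.mem_iSup_of_directed _ hdir] at *
    · exact ⟨0, hv v⟩
    · refine ⟨1, ?_⟩
      rw [← edge_mul_vertex]
      exact edge_mul_mem_depthFiltration (n := 0) e (hv _)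
    · refine ⟨0, ?_⟩
      rw [← ghost_mul_vertex]
      exact ghost_mul_mem_ghostSpan e (hv _)
    · exact hy.imp fun n h => vertex_mul_mem_depthFiltration v h
    · exact hy.elim fun n h => ⟨n + 1, edge_mul_mem_depthFiltration e h⟩
    · exact hy.imp fun n h =>
        ghost_mul_mem_depthFiltration e (depthFiltration_mono n.le_succ h)
  exact (Submodule.mem_iSup_of_directed _ hdir).1 hx

open Classical in
/-- An element of the filtration is, up to ghost paths, a finite combination `∑ e e* z` of
elements starting with an edge. -/
theorem exists_edge_decomposition {n : ℕ} {x : LeavittPathAlgebra K V}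
    (hx : x ∈ depthFiltration K V (n + 1)) :
    ∃ g ∈ ghostSpan K V, ∃ (z : LeavittPathAlgebra K V) (F : Finset (Quiver.Total V)),
      x = g + z ∧ z = ∑ e ∈ F, edge K e * (ghost K e * z) := by
  let D : Submodule K (LeavittPathAlgebra K V) :=
    { carrier := {z | ∃ F : Finset (Quiver.Total V), ∀ F', F ⊆ F' →
        z = ∑ e ∈ F', edge K e * (ghost K e * z)}
      zero_mem' := ⟨∅, fun F' _ => by simp⟩
      add_mem' := by
        rintro a b ⟨F, hF⟩ ⟨G, hG⟩
        refine ⟨F ∪ G, fun F' hF' => ?_⟩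
        simp only [mul_add, Finset.sum_add_distrib]
        rw [← hF F' (Finset.union_subset_left hF'), ← hG F' (Finset.union_subset_right hF')]
      smul_mem' := by
        rintro k a ⟨F, hF⟩
        refine ⟨F, fun F' hF' => ?_⟩
        simp only [mul_smul_comm]
        rw [← Finset.smul_sum, ← hF F' hF'] }
  obtain ⟨g, hg, z, hz, rfl⟩ := Submodule.mem_sup.1 hx
  have hzD : z ∈ D := by
    refine Submodule.span_le.2 ?_ hz
    rintro _ ⟨f, y, -, rfl⟩
    refine ⟨{f}, fun F' hF' => ?_⟩
    rw [Finset.sum_eq_single f]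
    · rw [← mul_assoc (ghost K f), ghost_mul_edge, ← mul_assoc, edge_mul_vertex]
    · intro e _ he
      rw [← mul_assoc (ghost K e), ghost_mul_edge_of_ne K he, zero_mul, mul_zero]
    · exact fun h => absurd (hF' (Finset.mem_singleton_self f)) h
  obtain ⟨F, hF⟩ := hzD
  exact ⟨g, hg, z, F, rfl, hF F subset_rfl⟩

/-! ### Annihilators of hereditary sets and density -/

/-- If every vertex connects to `H`, then `w L x = 0` for all `w ∈ H` forces `x = 0`. In the
induction over the filtration all products `e* x` vanish, and `v x = 0` is shown vertex by vertex:
by (CK2) for regular `v`; for a sink because `v x` is a combination of ghost paths; and for an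
infinite emitter because `e* x` for an edge `e` that does not occur in `x` sees only the ghost
paths in `x`. -/
theorem eq_zero_of_forall_vertex_mul_mul {H : Set V} (hH : ∀ v : V, ∃ w ∈ H, Connects v w)
    {x : LeavittPathAlgebra K V} (hx : ∀ w ∈ H, ∀ a, vertex K w * (a * x) = 0) : x = 0 := by
  have hghost : ∀ v, ∀ x ∈ ghostSpanAt K v, (∀ w ∈ H, ∀ a, vertex K w * (a * x) = 0) →
      x = 0 := by
    intro v x hxv hx
    obtain ⟨w, hw, ⟨q⟩⟩ := hH v
    refine eq_zero_of_ghostPath_mul q hxv ?_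
    rw [← vertex_mul_ghostPath, mul_assoc]
    exact hx w hw _
  have hmul : ∀ {x : LeavittPathAlgebra K V}, (∀ w ∈ H, ∀ a, vertex K w * (a * x) = 0) →
      ∀ b, ∀ w ∈ H, ∀ a, vertex K w * (a * (b * x)) = 0 := by
    intro x hx b w hw a
    rw [← mul_assoc a]
    exact hx w hw _
  obtain ⟨n, hn⟩ := exists_mem_depthFiltration x
  induction n generalizing x with
  | zero =>
    exact eq_zero_of_forall_vertex_mul fun v =>
      hghost v _ (vertex_mul_mem_ghostSpanAt v hn) (hmul hx _)
  | succ n ih =>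
    have hex : ∀ e, ghost K e * x = 0 := fun e =>
      ih (hmul hx _) (ghost_mul_mem_depthFiltration e hn)
    obtain ⟨g, hg, z, F, rfl, hz⟩ := exists_edge_decomposition hn
    have hez : ∀ e, ghost K e * z = -(ghost K e * g) := fun e => by
      rw [eq_neg_iff_add_eq_zero, add_comm, ← mul_add, hex]
    -- The summands of `v z` are `-(e e* g)` for edges `e` with source `v`.
    have hvz : ∀ v, vertex K v * g = 0 → vertex K v * z = 0 := by
      intro v hvg
      rw [hz, Finset.mul_sum]
      refine Finset.sum_eq_zero fun e _ => ?_
      by_cases h : v = e.left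
      · rw [hez, ← ghost_mul_vertex, mul_assoc _ _ g, ← h, hvg, mul_zero, neg_zero, mul_zero,
          mul_zero]
      · rw [← mul_assoc, vertex_mul_edge_of_ne K h, zero_mul]
    refine eq_zero_of_forall_vertex_mul fun v => ?_
    rcases (outEdges v).eq_empty_or_nonempty with hsink | hne
    · have hz0 : vertex K v * z = 0 := by
        rw [hz, Finset.mul_sum]
        refine Finset.sum_eq_zero fun e _ => ?_
        have h : v ≠ e.left := fun h => (hsink.subset (show e ∈ outEdges v from h.symm)).elim
        rw [← mul_assoc, vertex_mul_edge_of_ne K h, zero_mul]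
      refine hghost v _ ?_ (hmul hx _)
      rw [mul_add, hz0, add_zero]
      exact vertex_mul_mem_ghostSpanAt v hg
    · by_cases hfin : (outEdges v).Finite
      · rw [leavittFamily.ck2 v ⟨hne, hfin⟩, Finset.sum_mul]
        exact Finset.sum_eq_zero fun e _ => by rw [mul_assoc, hex, mul_zero]
      · obtain ⟨e, rfl, heF⟩ := Set.Infinite.exists_notMem_finset hfin F
        have hez0 : ghost K e * z = 0 := by
          rw [hz, Finset.mul_sum]
          refine Finset.sum_eq_zero fun f hf => ?_
          rw [← mul_assoc, ghost_mul_edge_of_ne K (ne_of_mem_of_not_mem hf heF).symm, zero_mul]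
        have hvg : vertex K e.left * g = 0 := by
          refine eq_zero_of_ghost_mul e (vertex_mul_mem_ghostSpanAt _ hg) ?_
          rw [← mul_assoc, ghost_mul_vertex, ← neg_eq_zero, ← hez, hez0]
        rw [mul_add, hvg, hvz _ hvg, add_zero]

/-- For a hereditary set `H`, `w ∈ H` and a vertex `v` that does not connect to `H`, every
monomial in `w L v` vanishes. -/
theorem vertex_mul_mul_vertex_eq_zero {H : Set V} (hH : IsHereditary H) {v : V}
    (hv : ∀ w ∈ H, ¬ Connects v w) {w : V} (hw : w ∈ H) (x : LeavittPathAlgebra K V) :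
    vertex K w * x * vertex K v = 0 := by
  obtain ⟨n, hn⟩ := exists_mem_depthFiltration x
  have hg : ∀ w ∈ H, ghostSpan K V ≤
      LinearMap.ker (LinearMap.mulRight K (vertex K v) ∘ₗ LinearMap.mulLeft K (vertex K w)) := by
    refine fun w hw => ghostSpan_induction fun {u t} p => ?_
    change vertex K w * ghostPath K p * vertex K v = 0
    by_cases hwt : w = t
    · by_cases huv : u = v
      · subst hwt huv
        exact absurd ⟨p⟩ (hv w hw)
      · rw [mul_assoc, ghostPath_mul_vertex_of_ne huv, mul_zero]
    · rw [vertex_mul_ghostPath_of_ne hwt, zero_mul]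
  induction n generalizing x w with
  | zero => exact hg w hw hn
  | succ n ih =>
    refine depthFiltration_succ_le (hg w hw) (fun e y hy => ?_) hn
    change vertex K w * (edge K e * y) * vertex K v = 0
    by_cases hwe : w = e.left
    · have he : e.right ∈ H := hH _ _ (hwe ▸ hw) ⟨e.hom.toPath⟩
      rw [hwe, ← mul_assoc, vertex_mul_edge, ← edge_mul_vertex, mul_assoc, mul_assoc,
        ← mul_assoc (vertex K e.right), ih he y hy, mul_zero]
    · rw [← mul_assoc, vertex_mul_edge_of_ne K hwe, zero_mul, zero_mul]

theorem vertex_mem_vertexIdeal {H : Set V} {w : V} (hw : w ∈ H) :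
    vertex K w ∈ vertexIdeal K H :=
  TwoSidedIdeal.subset_span ⟨w, hw, rfl⟩

theorem mul_vertex_eq_zero_of_mem {H : Set V} {v : V}
    (h : ∀ w ∈ H, ∀ a, vertex K w * a * vertex K v = 0) {x : LeavittPathAlgebra K V}
    (hx : x ∈ vertexIdeal K H) : x * vertex K v = 0 := by
  let J : TwoSidedIdeal (LeavittPathAlgebra K V) :=
    TwoSidedIdeal.mk' {x | ∀ a, x * a * vertex K v = 0}
      (fun a => by rw [zero_mul, zero_mul])
      (fun {x y} hx hy a => by rw [add_mul, add_mul, hx, hy, add_zero])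
      (fun {x} hx a => by rw [neg_mul, neg_mul, hx, neg_zero])
      (fun {x y} hy a => by rw [mul_assoc x, mul_assoc x, hy, mul_zero])
      (fun {x y} hx a => by rw [mul_assoc x, hx])
  have hJ : vertexIdeal K H ≤ J := by
    refine TwoSidedIdeal.span_le.2 ?_
    rintro _ ⟨w, hw, rfl⟩
    exact (TwoSidedIdeal.mem_mk' _ _ _ _ _ _ _).2 (h w hw)
  have := (TwoSidedIdeal.mem_mk' _ _ _ _ _ _ _).1 (hJ hx) (vertex K v)
  rwa [mul_assoc, vertex_mul_vertex] at this

theorem vertex_mul_eq_zero_of_mem {H : Set V} {v : V}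
    (h : ∀ w ∈ H, ∀ a, vertex K v * a * vertex K w = 0) {x : LeavittPathAlgebra K V}
    (hx : x ∈ vertexIdeal K H) : vertex K v * x = 0 := by
  let J : TwoSidedIdeal (LeavittPathAlgebra K V) :=
    TwoSidedIdeal.mk' {x | ∀ a, vertex K v * a * x = 0}
      (fun a => by rw [mul_zero])
      (fun {x y} hx hy a => by rw [mul_add, hx, hy, add_zero])
      (fun {x} hx a => by rw [mul_neg, hx, neg_zero])
      (fun {x y} hy a => by rw [← mul_assoc, mul_assoc (vertex K v), hy])
      (fun {x y} hx a => by rw [← mul_assoc, hx, zero_mul])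
  have hJ : vertexIdeal K H ≤ J := by
    refine TwoSidedIdeal.span_le.2 ?_
    rintro _ ⟨w, hw, rfl⟩
    exact (TwoSidedIdeal.mem_mk' _ _ _ _ _ _ _).2 (h w hw)
  have := (TwoSidedIdeal.mem_mk' _ _ _ _ _ _ _).1 (hJ hx) (vertex K v)
  rwa [vertex_mul_vertex] at this

theorem isDenseLeft_vertexIdeal_iff {H : Set V} (hH : IsHereditary H) :
    IsDenseLeft (vertexIdeal K H) ↔ ∀ v : V, ∃ w ∈ H, Connects v w := by
  constructor
  · intro hd v
    by_contra! hv
    obtain ⟨r, hr, hrI⟩ := hd (vertex K v) (vertex K v) (vertex_ne_zero v)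
    have h := mul_vertex_eq_zero_of_mem
      (fun w hw a => vertex_mul_mul_vertex_eq_zero hH hv hw a) hrI
    rw [mul_assoc, vertex_mul_vertex] at h
    exact hr h
  · intro hc x y hx
    obtain ⟨w, hw, a, ha⟩ : ∃ w ∈ H, ∃ a, vertex K w * (a * x) ≠ 0 := by
      by_contra! h
      exact hx (eq_zero_of_forall_vertex_mul_mul hc h)
    refine ⟨vertex K w * a, by rwa [mul_assoc], ?_⟩
    rw [mul_assoc]
    exact TwoSidedIdeal.mul_mem_right _ _ _ (vertex_mem_vertexIdeal hw)

theorem isDenseRight_vertexIdeal_iff {H : Set V} (hH : IsHereditary H) :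
    IsDenseRight (vertexIdeal K H) ↔ ∀ v : V, ∃ w ∈ H, Connects v w := by
  obtain ⟨σ, hmul, hσ, h0, hv'⟩ := exists_involution (K := K) (V := V)
  constructor
  · intro hd v
    by_contra! hv
    obtain ⟨r, hr, hrI⟩ := hd (vertex K v) (vertex K v) (vertex_ne_zero v)
    have hzero : ∀ w ∈ H, ∀ a, vertex K v * a * vertex K w = 0 := by
      intro w hw a
      have h := vertex_mul_mul_vertex_eq_zero hH hv hw (σ a)
      rw [← hσ (vertex K v * a * vertex K w), hmul _ (vertex K w), hmul (vertex K v), hv', hv',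
        ← mul_assoc, h, h0]
    have h := vertex_mul_eq_zero_of_mem hzero hrI
    rw [← mul_assoc, vertex_mul_vertex] at h
    exact hr h
  · intro hc x y hx
    have hσx : σ x ≠ 0 := fun h => hx (by rw [← hσ x, h, h0])
    obtain ⟨w, hw, a, ha⟩ : ∃ w ∈ H, ∃ a, vertex K w * (a * σ x) ≠ 0 := by
      by_contra! h
      exact hσx (eq_zero_of_forall_vertex_mul_mul hc h)
    refine ⟨σ a * vertex K w, fun h => ha ?_, ?_⟩
    · have h' := congrArg σ h
      rwa [hmul, hmul, hσ, hv', h0, mul_assoc] at h'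
    · rw [← mul_assoc]
      exact TwoSidedIdeal.mul_mem_left _ _ _ (vertex_mem_vertexIdeal hw)

end LeavittPathAlgebra
end LPA

theorem proposition1p10 {K : Type*} [Field K] {V : Type*} [Quiver V]
    (H : Set V) (hH : LPA.IsHereditary H) :
    (LPA.IsDenseLeft (LPA.LeavittPathAlgebra.vertexIdeal K H) ↔
      ∀ v : V, ∃ w ∈ H, LPA.Connects v w) ∧
    (LPA.IsDenseRight (LPA.LeavittPathAlgebra.vertexIdeal K H) ↔
      ∀ v : V, ∃ w ∈ H, LPA.Connects v w) :=
  ⟨LPA.LeavittPathAlgebra.isDenseLeft_vertexIdeal_iff hH,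
    LPA.LeavittPathAlgebra.isDenseRight_vertexIdeal_iff hH⟩
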